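/- Definitions. Let $\alpha$ be an ordinal. A group $G$ is $\alpha$-residually finite if there are subgroups $(G_\beta)_{\beta\le\alpha}$ of $G$ with $G_0=G$, $G_\alpha=\{1\}$, $G_\gamma\le G_\beta$ whenever $\beta<\gamma\le\alpha$, $[G_\beta:G_{\beta+1}]<\infty$ for all $\beta<\alpha$, and $G_\lambda=\bigcap_{\beta<\lambda}G_\beta$ for all limit ordinals $\lambda\le\alpha$. If $G$ is $\alpha$-residually finite for some ordinal $\alpha$, the least such $\alpha$ is the residual finiteness depth of $G$, written $\operatorname{depth}(G)$; otherwise $\operatorname{depth}(G)$ is undefined. Proposition. Let $\Gamma$ be a countable group whose residual finiteness depth $\operatorname{depth}(\Gamma)$ is defined and is a limit ordinal with $\operatorname{depth}(\Gamma)\ge\omega^2$. Then there exist a group $\Gamma^+$ generated by three elements and an injective homomorphism $\Gamma\hookrightarrow\Gamma^+$ such that $\operatorname{depth}(\Gamma^+)$ is defined and $\operatorname{depth}(\Gamma^+)=\operatorname{depth}(\Gamma)$. -/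

import Mathlib

universe u v

/-- `G` is `α`-residually finite: there is a descending chain of subgroups `(C β)` indexed by the
ordinals `β ≤ α`, starting at `G`, ending at the trivial group, with finite index at each successor
step and continuous at limit ordinals. (The values of `C` beyond `α` are irrelevant.) -/
def IsOrdinalResiduallyFinite (G : Type u) [Group G] (α : Ordinal.{v}) : Prop :=
  ∃ C : Ordinal.{v} → Subgroup G,
    C 0 = ⊤ ∧ C α = ⊥ ∧
    (∀ β γ : Ordinal.{v}, β < γ → γ ≤ α → C γ ≤ C β) ∧
    (∀ β : Ordinal.{v}, β < α → (C (β + 1)).relIndex (C β) ≠ 0) ∧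
    (∀ l : Ordinal.{v}, Order.IsSuccLimit l → l ≤ α → C l = ⨅ β ∈ Set.Iio l, C β)

/-- The residual finiteness depth of `G` exists and equals `α`: the ordinal `α` is the least one
for which `G` is `α`-residually finite. -/
def HasResidualFinitenessDepth (G : Type u) [Group G] (α : Ordinal.{v}) : Prop :=
  IsLeast {β : Ordinal.{v} | IsOrdinalResiduallyFinite G β} α

open scoped commutatorElement

/-! Every countable `Γ` embeds in a two-generator subgroup `P` of the iterated unrestricted wreath
product `(Γ ≀ᵣ ℤ) ≀ᵣ ℤ`. Chains restrict to subgroups, so `P` has depth at least that of `Γ`, and it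
remains to see that the wreath product with `ℤ` preserves `α`-residual finiteness. Its base group, a
countable power, is again `α`-residually finite because `α` is a limit (`pi`). The quotient `ℤ`
costs `ω` further steps at the top (`extension`), absorbed since `ω + α = α` for `α ≥ ω ^ 2`. -/

open Ordinal in
theorem Ordinal.finite_setOf_add_natCast_eq (β : Ordinal.{v}) :
    {n : ℕ | ∃ γ : Ordinal.{v}, γ + n = β}.Finite := by
  obtain ⟨k, hk⟩ := lt_omega0.1 (mod_lt β omega0_ne_zero)
  refine (Set.finite_Iic k).subset ?_
  rintro n ⟨γ, rfl⟩
  obtain ⟨r, hr⟩ := lt_omega0.1 (mod_lt γ omega0_ne_zero)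
  have h : γ + n = ω * (γ / ω) + ((r + n : ℕ) : Ordinal.{v}) := by
    conv_lhs => rw [← div_add_mod γ ω]
    rw [hr, add_assoc, Nat.cast_add]
  rw [h, mul_add_mod_self, mod_eq_of_lt (natCast_lt_omega0 _), Nat.cast_inj] at hk
  exact Set.mem_Iic.2 (by omega)

open Ordinal in
theorem Ordinal.omega0_add_of_sq_le {α : Ordinal.{v}} (h : ω ^ 2 ≤ α) : ω + α = α := by
  rw [← Ordinal.add_sub_cancel_of_le h, ← add_assoc]
  congr 1
  rw [sq]
  nth_rw 1 [← mul_one ω]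
  rw [← mul_add, one_add_omega0]

/-! ### Closure properties of ordinal residual finiteness -/

namespace IsOrdinalResiduallyFinite

variable {G : Type*} [Group G] {H : Type*} [Group H] {α β : Ordinal.{v}}

theorem of_injective (h : IsOrdinalResiduallyFinite H α) (f : G →* H)
    (hf : Function.Injective f) : IsOrdinalResiduallyFinite G α := by
  obtain ⟨C, h0, hα, hmono, hfin, hlim⟩ := h
  refine ⟨fun β => (C β).comap f, ?_, ?_, ?_, ?_, ?_⟩
  · simp [h0]
  · simp only [hα]
    exact (MonoidHom.comap_bot f).trans ((MonoidHom.ker_eq_bot_iff f).2 hf)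
  · exact fun β γ hβ hγ => Subgroup.comap_mono (hmono β γ hβ hγ)
  · exact fun β hβ => Subgroup.relIndex_comap_ne_zero f (hfin β hβ)
  · intro l hl hle
    simp only [hlim l hl hle, Subgroup.comap_iInf]

theorem extension (f : G →* H) (hH : IsOrdinalResiduallyFinite H β)
    (hK : IsOrdinalResiduallyFinite f.ker α) : IsOrdinalResiduallyFinite G (β + α) := by
  obtain ⟨C, C0, Cβ, Cmono, Cfin, Clim⟩ := hH
  obtain ⟨E, E0, Eα, Emono, Efin, Elim⟩ := hK
  have hinj := f.ker.subtype_injective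
  set D : Ordinal.{v} → Subgroup G := fun γ =>
    if γ ≤ β then (C γ).comap f else (E (γ - β)).map f.ker.subtype with hD
  have D1 : ∀ γ ≤ β, D γ = (C γ).comap f := fun γ h => if_pos h
  have D2 : ∀ δ, D (β + δ) = (E δ).map f.ker.subtype := by
    intro δ
    rcases eq_or_ne δ 0 with rfl | hδ
    · rw [add_zero, D1 β le_rfl, Cβ, E0, ← MonoidHom.range_eq_map, Subgroup.range_subtype,
        MonoidHom.comap_bot]
    · have : ¬ β + δ ≤ β := by simpa using hδ
      simp only [hD, if_neg this, Ordinal.add_sub_cancel]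
  have Dmono : ∀ γ δ : Ordinal.{v}, γ < δ → δ ≤ β + α → D δ ≤ D γ := by
    intro γ δ hγδ hδ
    rcases le_or_gt δ β with h | h
    · rw [D1 δ h, D1 γ (hγδ.le.trans h)]
      exact Subgroup.comap_mono (Cmono _ _ hγδ h)
    · obtain ⟨δ', rfl⟩ := exists_add_of_le h.le
      rw [D2]
      rcases le_or_gt β γ with h' | h'
      · obtain ⟨γ', rfl⟩ := exists_add_of_le h'
        rw [D2]
        exact Subgroup.map_mono
          (Emono _ _ ((add_lt_add_iff_left β).1 hγδ) ((add_le_add_iff_left β).1 hδ))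
      · rw [D1 γ h'.le]
        rintro _ ⟨x, -, rfl⟩
        have hx : f (f.ker.subtype x) = 1 := x.2
        rw [Subgroup.mem_comap, hx]
        exact one_mem _
  refine ⟨D, ?_, ?_, Dmono, ?_, ?_⟩
  · simp [D1, C0]
  · simp [D2, Eα]
  · intro γ hγ
    rcases lt_or_ge γ β with h | h
    · rw [D1 γ h.le, D1 (γ + 1) (Order.add_one_le_of_lt h)]
      exact Subgroup.relIndex_comap_ne_zero f (Cfin γ h)
    · obtain ⟨γ', rfl⟩ := exists_add_of_le h
      rw [add_assoc, D2, D2, Subgroup.relIndex_map_map_of_injective _ _ hinj]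
      exact Efin γ' ((add_lt_add_iff_left β).1 hγ)
  · intro l hl hle
    refine le_antisymm (le_iInf₂ fun γ hγ => Dmono γ l hγ hle) ?_
    rcases le_or_gt l β with h | h
    · rw [D1 l h, Clim l hl h, Subgroup.comap_iInf]
      refine le_iInf fun γ => ?_
      rw [Subgroup.comap_iInf]
      refine le_iInf fun hγ => (iInf₂_le γ hγ).trans (D1 γ (le_of_lt hγ |>.trans h)).le
    · have hl' := Ordinal.isSuccLimit_sub hl.isSuccPrelimit h
      obtain ⟨l', rfl⟩ := exists_add_of_le h.le
      rw [Ordinal.add_sub_cancel] at hl'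
      rw [D2, Elim l' hl' ((add_le_add_iff_left β).1 hle)]
      intro x hx
      simp only [Subgroup.mem_iInf] at hx
      have hxβ := hx (β + 0) ((add_lt_add_iff_left β).2 hl'.bot_lt)
      rw [D2] at hxβ
      obtain ⟨y, -, rfl⟩ := hxβ
      refine ⟨y, ?_, rfl⟩
      simp only [SetLike.mem_coe, Subgroup.mem_iInf]
      intro γ hγ
      have := hx (β + γ) ((add_lt_add_iff_left β).2 hγ)
      rw [D2] at this
      exact (Subgroup.mem_map_iff_mem hinj).1 this

/-- Run the chain of `G` in coordinate `x` with delay `e x`. Distinct finite delays let only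
finitely many coordinates move at each step, and a limit `α` absorbs them all. -/
theorem pi (h : IsOrdinalResiduallyFinite G α) (hα : Order.IsSuccLimit α) (X : Type*)
    [Countable X] : IsOrdinalResiduallyFinite (X → G) α := by
  obtain ⟨C, C0, Cα, Cmono, Cfin, Clim⟩ := h
  obtain ⟨e, he⟩ := exists_injective_nat X
  have mem_lim : ∀ l, Order.IsSuccLimit l → l ≤ α → ∀ g, (∀ γ < l, g ∈ C γ) → g ∈ C l := by
    intro l hl hle g hg
    rw [Clim l hl hle]
    simpa only [Subgroup.mem_iInf, Set.mem_Iio] using hg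
  have add_lt : ∀ l : Ordinal.{v}, Order.IsSuccLimit l → ∀ γ < l, ∀ n : ℕ, γ + n < l := by
    intro l hl γ hγ n
    induction n with
    | zero => simpa using hγ
    | succ n ih =>
      rw [Nat.cast_succ, ← add_assoc]
      exact hl.succ_lt ih
  let D : Ordinal.{v} → Subgroup (X → G) := fun β =>
    ⨅ (x : X) (γ : Ordinal.{v}) (_ : γ + e x ≤ β), (C γ).comap (Pi.evalMonoidHom _ x)
  have memD : ∀ β f, f ∈ D β ↔ ∀ x γ, γ + e x ≤ β → f x ∈ C γ := by
    intro β f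
    simp [D, Subgroup.mem_iInf]
  refine ⟨D, ?_, ?_, ?_, ?_, ?_⟩
  · refine eq_top_iff.2 fun f _ => (memD _ _).2 fun x γ hγ => ?_
    have : γ = 0 := by
      have := (le_self_add (a := γ) (b := (e x : Ordinal.{v}))).trans hγ
      simpa using this
    simp [this, C0]
  · refine eq_bot_iff.2 fun f hf => Subgroup.mem_bot.2 (funext fun x => ?_)
    rw [memD] at hf
    have := mem_lim α hα le_rfl (f x) fun γ hγ => hf x γ (add_lt α hα γ hγ _).le
    simpa [Cα] using this
  · intro β γ hβγ _ f hf
    rw [memD] at hf ⊢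
    exact fun x δ hδ => hf x δ (hδ.trans hβγ.le)
  · intro β hβ
    -- The coordinates that may move from `β` to `β + 1`; their delays are bounded by the finite
    -- part of `β`.
    let S := {x : X // ∃ γ : Ordinal.{v}, γ + e x = β}
    have : Finite S :=
      ((Ordinal.finite_setOf_add_natCast_eq β).preimage he.injOn).to_subtype
    choose g hg using fun x : S => x.2
    have hle : D β ⊓ ⨅ x : S, (C (g x + 1)).comap (Pi.evalMonoidHom (fun _ => G) x.1) ≤
        D (β + 1) := by
      intro f hfin
      obtain ⟨hf, hf'⟩ := Subgroup.mem_inf.1 hfin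
      simp only [Subgroup.mem_iInf, Subgroup.mem_comap, Pi.evalMonoidHom_apply] at hf'
      rw [memD] at hf ⊢
      intro x γ hγ
      rcases hγ.lt_or_eq with h | h
      · exact hf x γ (Order.lt_add_one_iff.1 h)
      rcases Ordinal.zero_or_succ_or_isSuccLimit γ with rfl | ⟨γ, rfl⟩ | hl
      · simp [C0]
      · rw [Order.succ_eq_add_one] at h ⊢
        have h' : γ + e x = β := by
          rw [add_assoc, ← Nat.cast_one, ← Nat.cast_add, add_comm 1, Nat.cast_add,
            ← add_assoc] at h
          exact (Ordinal.add_right_cancel 1).1 h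
        have := hf' ⟨x, γ, h'⟩
        rwa [(Ordinal.add_right_cancel (e x)).1 ((hg ⟨x, γ, h'⟩).trans h'.symm)] at this
      -- Reaching a limit `γ` imposes nothing new, by continuity of `C`.
      · have hγα : γ ≤ α := le_self_add.trans (hγ.trans (Order.add_one_le_of_lt hβ))
        refine mem_lim γ hl hγα _ fun δ hδ => hf x δ ?_
        exact Order.lt_add_one_iff.1 ((add_lt γ hl δ hδ _).trans_le (le_self_add.trans hγ))
    refine fun h0 => ?_
    have h1 := Subgroup.relIndex_eq_zero_of_le_left hle h0
    rw [Subgroup.inf_relIndex_left] at h1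
    refine Subgroup.relIndex_iInf_ne_zero (fun x => ?_) h1
    have hDx : D β ≤ (C (g x)).comap (Pi.evalMonoidHom (fun _ => G) x.1) :=
      fun f hf => (memD β f).1 hf x.1 (g x) (hg x).le
    refine fun h2 => Subgroup.relIndex_comap_ne_zero (Pi.evalMonoidHom (fun _ => G) x.1)
      (Cfin (g x) ?_) (Subgroup.relIndex_eq_zero_of_le_right hDx h2)
    exact (le_self_add.trans (hg x).le).trans_lt hβ
  · intro l hl hle
    ext f
    simp only [Subgroup.mem_iInf, Set.mem_Iio, memD]
    refine ⟨fun hf β hβ x γ hγ => hf x γ (hγ.trans hβ.le), fun hf x γ hγ => ?_⟩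
    rcases hγ.lt_or_eq with h | h
    · exact hf _ h x γ le_rfl
    have hγl : γ = l := by
      by_contra hne
      exact (add_lt l hl γ (lt_of_le_of_ne (le_self_add.trans hγ) hne) (e x)).ne h
    subst hγl
    exact mem_lim γ hl hle _ fun δ hδ => hf _ (add_lt γ hl δ hδ (e x)) x δ le_rfl

theorem multiplicative_int :
    IsOrdinalResiduallyFinite (Multiplicative ℤ) Ordinal.omega0.{v} := by
  let K : ℕ → Subgroup (Multiplicative ℤ) := fun k =>
    (AddMonoidHom.toMultiplicative (Int.castAddHom (ZMod (2 ^ k)))).ker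
  have memK : ∀ k m, m ∈ K k ↔ (2 : ℤ) ^ k ∣ m.toAdd := by
    intro k m
    have : m ∈ K k ↔ ((m.toAdd : ℤ) : ZMod (2 ^ k)) = 0 := Iff.rfl
    rw [this, ZMod.intCast_zmod_eq_zero_iff_dvd]
    simp
  have finK : ∀ k, (K k).FiniteIndex := fun k => by
    have : Finite (Multiplicative (ZMod (2 ^ k))) := inferInstanceAs (Finite (ZMod (2 ^ k)))
    exact Subgroup.finiteIndex_ker _
  let C : Ordinal.{v} → Subgroup (Multiplicative ℤ) := fun β =>
    ⨅ (k : ℕ) (_ : (k : Ordinal.{v}) ≤ β), K k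
  have memC : ∀ β m, m ∈ C β ↔ ∀ k : ℕ, (k : Ordinal.{v}) ≤ β → m ∈ K k := by
    intro β m
    simp [C, Subgroup.mem_iInf]
  refine ⟨C, ?_, ?_, ?_, ?_, ?_⟩
  · refine eq_top_iff.2 fun m _ => (memC _ _).2 fun k hk => ?_
    have : k = 0 := by simpa using hk
    simp [memK, this]
  · refine eq_bot_iff.2 fun m hm => Subgroup.mem_bot.2 ?_
    rw [memC] at hm
    have h := (memK _ _).1 (hm m.toAdd.natAbs (Ordinal.natCast_lt_omega0 _).le)
    have h0 := Int.eq_zero_of_abs_lt_dvd h (by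
      rw [Int.abs_eq_natAbs]
      exact_mod_cast Nat.lt_two_pow_self)
    exact h0
  · intro β γ hβγ _ m hm
    rw [memC] at hm ⊢
    exact fun k hk => hm k (hk.trans hβγ.le)
  · intro β hβ
    obtain ⟨n, rfl⟩ := Ordinal.lt_omega0.1 hβ
    have hle : K (n + 1) ≤ C (n + 1) := by
      intro m hm
      rw [memC]
      intro k hk
      rw [memK] at hm ⊢
      exact (pow_dvd_pow 2 (by exact_mod_cast hk)).trans hm
    have := finK (n + 1)
    have := Subgroup.finiteIndex_of_le hle
    exact Subgroup.isFiniteRelIndex_of_finiteIndex.relIndex_ne_zero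
  · intro l hl _
    ext m
    simp only [Subgroup.mem_iInf, Set.mem_Iio, memC]
    exact ⟨fun h β hβ k hk => h k (hk.trans hβ.le), fun h k _ =>
      h k (Ordinal.natCast_lt_of_isSuccLimit hl k) k le_rfl⟩

open RegularWreathProduct in
theorem regularWreathProduct [Countable H] (hH : IsOrdinalResiduallyFinite H β)
    (hG : IsOrdinalResiduallyFinite G α) (hα : Order.IsSuccLimit α) :
    IsOrdinalResiduallyFinite (G ≀ᵣ H) (β + α) := by
  refine extension rightHom hH ((hG.pi hα H).of_injective
    { toFun := fun w => w.1.left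
      map_one' := rfl
      map_mul' := fun a b => ?_ } ?_)
  · have ha : a.1.right = 1 := a.2
    simp [ha]
  · intro a b hab
    have ha : a.1.right = 1 := a.2
    have hb : b.1.right = 1 := b.2
    exact Subtype.ext (RegularWreathProduct.ext hab (ha.trans hb.symm))

end IsOrdinalResiduallyFinite

/-! ### Two-generator subgroups of wreath products -/

namespace RegularWreathProduct

variable {D : Type*} [Group D] {Q : Type*} [Group Q]

/-- The inclusion of the base group of a regular wreath product. -/
def base : (Q → D) →* D ≀ᵣ Q where
  toFun f := ⟨f, 1⟩
  map_one' := rfl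
  map_mul' f g := by ext <;> simp

theorem base_injective : Function.Injective (base : (Q → D) →* D ≀ᵣ Q) :=
  fun _ _ h => congrArg RegularWreathProduct.left h

theorem inl_inv_mul_base_mul_inl (q : Q) (f : Q → D) :
    (inl q)⁻¹ * base f * inl q = base fun x => f (q * x) := by
  ext <;> simp [base]

/-- The embedding of a group in a regular wreath product as the coordinate at `q`. -/
def single [DecidableEq Q] (q : Q) : D →* D ≀ᵣ Q :=
  base.comp (MonoidHom.mulSingle (fun _ : Q => D) q)

theorem single_injective [DecidableEq Q] (q : Q) :
    Function.Injective (single q : D →* D ≀ᵣ Q) :=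
  base_injective.comp (Pi.mulSingle_injective (M := fun _ => D) q)

-- A step function and its translate by one differ at a single point. Hence each `g`, placed in one
-- coordinate, is a commutator whose first entry does not depend on `g`.
open Multiplicative in
theorem commutator_inl_base_step (g : D) :
    ⁅(inl (ofAdd (1 : ℤ)) : D ≀ᵣ Multiplicative ℤ)⁻¹,
      base fun x => if 0 ≤ x.toAdd then g else 1⁆ = single (ofAdd (-1)) g := by
  rw [commutatorElement_def, inv_inv, inl_inv_mul_base_mul_inl, ← map_inv, ← map_mul]
  refine congrArg base (funext fun x => ?_)
  obtain ⟨x, rfl⟩ := ofAdd.surjective x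
  have h1 : (0 ≤ 1 + x) ↔ (x = -1 ∨ 0 ≤ x) := by omega
  by_cases h : x = -1
  · subst h
    simp
  · have h2 : ofAdd x ≠ ofAdd (-1) := h
    rw [MonoidHom.mulSingle_apply, Pi.mulSingle_eq_of_ne h2]
    by_cases h' : 0 ≤ x <;> simp [h1, h, h']

/-- Parity: `b > 0` would force `a = 0`, and then the right side is too large. -/
theorem two_pow_eq_one_of_add_one_eq {a b i : ℕ} (h : (2 : ℤ) ^ a + 1 = 2 ^ b + 2 ^ (i + 1)) :
    (2 : ℤ) ^ b = 1 := by
  rcases b with _ | b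
  · simp
  rcases a with _ | a
  · have h1 : (0 : ℤ) < 2 ^ b := by positivity
    have h2 : (0 : ℤ) < 2 ^ i := by positivity
    simp only [pow_succ, pow_zero] at h
    omega
  · simp only [pow_succ] at h
    omega

/-- A two-generator subgroup of `D ≀ᵣ ℤ` containing the commutators of one term of a given sequence
with all the other ones. -/
theorem exists_single_commutator_mem_closure (y : ℕ → D) :
    ∃ a b : D ≀ᵣ Multiplicative ℤ, ∀ i,
      single 1 ⁅y 0, y (i + 1)⁆ ∈ Subgroup.closure {a, b} := by
  let e : ℕ → ℤ := fun i => 2 ^ i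
  have he : Function.Injective e := fun i j h => Int.pow_right_injective (by decide) h
  let F : ℤ → D := Function.extend e y 1
  have hF : ∀ i : ℕ, F (2 ^ i) = y i := fun i => he.extend_apply y (1 : ℤ → D) i
  have hF' : ∀ x, (¬ ∃ i : ℕ, (2 : ℤ) ^ i = x) → F x = 1 :=
    fun x hx => Function.extend_apply' y (1 : ℤ → D) x hx
  let φ : D ≀ᵣ Multiplicative ℤ := base fun x => F x.toAdd
  let s : D ≀ᵣ Multiplicative ℤ := inl (Multiplicative.ofAdd (1 : ℤ))
  refine ⟨φ, s, fun i => ?_⟩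
  have hφ : φ ∈ Subgroup.closure {φ, s} := Subgroup.subset_closure (by simp)
  have hs : s ∈ Subgroup.closure {φ, s} := Subgroup.subset_closure (by simp)
  have hshift : ∀ n : ℤ, (base fun x => F (n + x.toAdd)) ∈ Subgroup.closure {φ, s} := by
    intro n
    have h1 : (inl (Multiplicative.ofAdd n) : D ≀ᵣ Multiplicative ℤ) = s ^ n := by
      rw [← map_zpow, ← ofAdd_zsmul]
      simp
    have h2 := mul_mem (mul_mem (inv_mem (zpow_mem hs n)) hφ) (zpow_mem hs n)
    rw [← h1, inl_inv_mul_base_mul_inl] at h2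
    exact h2
  -- As `F` is supported on powers of two, these two translates have supports meeting at most at the
  -- origin, so the commutator vanishes elsewhere.
  have key : (single 1 ⁅y 0, y (i + 1)⁆ : D ≀ᵣ Multiplicative ℤ) =
      ⁅base fun x : Multiplicative ℤ => F (1 + x.toAdd),
        base fun x : Multiplicative ℤ => F (2 ^ (i + 1) + x.toAdd)⁆ := by
    rw [← map_commutatorElement]
    refine congrArg base (funext fun x => ?_)
    change Pi.mulSingle (M := fun _ => D) 1 ⁅y 0, y (i + 1)⁆ x = ⁅F (1 + x.toAdd), F (2 ^ (i + 1) + x.toAdd)⁆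
    by_cases hx : x = 1
    · subst hx
      have h0 : F 1 = y 0 := by simpa using hF 0
      simp [h0, hF]
    rw [Pi.mulSingle_eq_of_ne hx]
    by_cases h1 : ∃ b : ℕ, (2 : ℤ) ^ b = 1 + x.toAdd
    · by_cases h2 : ∃ a : ℕ, (2 : ℤ) ^ a = 2 ^ (i + 1) + x.toAdd
      · obtain ⟨b, hb⟩ := h1
        obtain ⟨a, ha⟩ := h2
        have := two_pow_eq_one_of_add_one_eq (a := a) (b := b) (i := i) (by rw [ha, hb]; ring)
        exact absurd (show x.toAdd = 0 by omega) hx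
      · rw [hF' _ h2, commutatorElement_one_right]
    · rw [hF' _ h1, commutatorElement_one_left]
  rw [key, commutatorElement_def]
  exact mul_mem (mul_mem (mul_mem (hshift _) (hshift _)) (inv_mem (hshift _)))
    (inv_mem (hshift _))

end RegularWreathProduct

open RegularWreathProduct in
theorem exists_single_single_mem_closure (G : Type*) [Group G] [Countable G] :
    ∃ a b : (G ≀ᵣ Multiplicative ℤ) ≀ᵣ Multiplicative ℤ, ∀ g : G,
      single 1 (single (Multiplicative.ofAdd (-1)) g) ∈ Subgroup.closure {a, b} := by
  obtain ⟨enum, henum⟩ := exists_surjective_nat G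
  obtain ⟨a, b, hab⟩ := exists_single_commutator_mem_closure (D := G ≀ᵣ Multiplicative ℤ)
    -- Term 0 is the common first entry of the commutators giving the elements of `G`.
    fun | 0 => (inl (Multiplicative.ofAdd (1 : ℤ)))⁻¹
        | i + 1 => base fun x => if 0 ≤ x.toAdd then enum i else 1
  refine ⟨a, b, fun g => ?_⟩
  obtain ⟨i, rfl⟩ := henum g
  simpa only [commutator_inl_base_step] using hab i

theorem proposition4p2 (Γ : Type u) [Group Γ] [Countable Γ] (α : Ordinal.{v})
    (hdepth : HasResidualFinitenessDepth Γ α) (hlim : Order.IsSuccLimit α)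
    (hα : Ordinal.omega0.{v} ^ 2 ≤ α) :
    ∃ (Γplus : Type u) (_ : Group Γplus) (ι : Γ →* Γplus),
      Function.Injective ι ∧
      (∃ a b c : Γplus, Subgroup.closure {a, b, c} = ⊤) ∧
      HasResidualFinitenessDepth Γplus α := by
  obtain ⟨a, b, hab⟩ := exists_single_single_mem_closure Γ
  let P := Subgroup.closure {a, b}
  let ι : Γ →* P := ((RegularWreathProduct.single 1).comp
    (RegularWreathProduct.single (Multiplicative.ofAdd (-1)))).codRestrict P hab
  have hι : Function.Injective ι := fun x y h =>
    RegularWreathProduct.single_injective _ (RegularWreathProduct.single_injective _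
      (congrArg Subtype.val h))
  have wreath : ∀ (G : Type u) [Group G], IsOrdinalResiduallyFinite G α →
      IsOrdinalResiduallyFinite (G ≀ᵣ Multiplicative ℤ) α := fun G _ hG => by
    simpa only [Ordinal.omega0_add_of_sq_le hα] using
      IsOrdinalResiduallyFinite.multiplicative_int.regularWreathProduct hG hlim
  refine ⟨P, inferInstance, ι, hι, ?_, ?_, ?_⟩
  -- Two generators suffice; `b` is repeated.
  · refine ⟨⟨a, Subgroup.subset_closure (by simp)⟩, ⟨b, Subgroup.subset_closure (by simp)⟩,
      ⟨b, Subgroup.subset_closure (by simp)⟩, ?_⟩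
    rw [← Subgroup.closure_closure_coe_preimage (k := {a, b})]
    congr 1
    ext x
    simp [Subtype.ext_iff]
  · exact (wreath _ (wreath _ hdepth.1)).of_injective P.subtype P.subtype_injective
  · exact fun β hβ => hdepth.2 (IsOrdinalResiduallyFinite.of_injective hβ ι hι)
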